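/- Let $k\ge 2$ be an integer and let $\alpha,\beta\in\mathbb C$ satisfy $|\alpha|^k<|\beta|\le|\alpha|^{k-1}$. Consider the automorphisms of $\mathbb C^2$ $$F(z_1,z_2)=(\alpha z_1+z_2^2,\ \beta z_2)\quad\text{and}\quad G(z_1,z_2)=(\beta z_1,\ \alpha z_2+z_1^k).$$ Let $\{F_n\}_{n\ge 1}$ be any sequence in which each $F_n$ is either $F$ or $G$. Then the non-autonomous basin of attraction of $\{F_n\}$ at the origin, $$\Omega_{\{F_n\}}=\{z\in\mathbb C^2:\ F_n\circ F_{n-1}\circ\cdots\circ F_1(z)\to 0\ \text{as}\ n\to\infty\},$$ is an open subset of $\mathbb C^2$ that is biholomorphic to $\mathbb C^2$. -/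

import Mathlib

open Filter Topology

/-- The map `F(z₁, z₂) = (α z₁ + z₂², β z₂)` of `ℂ²`. -/
def mapF (α β : ℂ) (z : ℂ × ℂ) : ℂ × ℂ := (α * z.1 + z.2 ^ 2, β * z.2)

/-- The map `G(z₁, z₂) = (β z₁, α z₂ + z₁ᵏ)` of `ℂ²`. -/
def mapG (α β : ℂ) (k : ℕ) (z : ℂ × ℂ) : ℂ × ℂ := (β * z.1, α * z.2 + z.1 ^ k)

/-- The composition of the first `n` maps of a sequence, the map `f 0` being applied first:
`nonautComp f n = f (n - 1) ∘ ⋯ ∘ f 1 ∘ f 0`, and `nonautComp f 0 = id`. -/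
def nonautComp {X : Type*} (f : ℕ → X → X) : ℕ → X → X
  | 0 => id
  | n + 1 => f n ∘ nonautComp f n

/-- The non-autonomous basin of attraction of the sequence `f` at the point `p`: the points
`z` such that `f (n - 1) ∘ ⋯ ∘ f 0` maps `z` to a sequence of points that tends to `p`. -/
def nonautBasin {X : Type*} [TopologicalSpace X] (f : ℕ → X → X) (p : X) : Set X :=
  {z | Tendsto (fun n => nonautComp f n z) atTop (𝓝 p)}

/-- `U` and `V` are open sets, and there is a holomorphic bijection of `U` onto `V` with
holomorphic inverse. -/
def Biholomorphic {E E' : Type*} [NormedAddCommGroup E] [NormedSpace ℂ E]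
    [NormedAddCommGroup E'] [NormedSpace ℂ E'] (U : Set E) (V : Set E') : Prop :=
  IsOpen U ∧ IsOpen V ∧ ∃ (φ : E → E') (ψ : E' → E),
    DifferentiableOn ℂ φ U ∧ DifferentiableOn ℂ ψ V ∧
    Set.MapsTo φ U V ∧ Set.MapsTo ψ V U ∧ Set.InvOn ψ φ U V


/-!
Write each map of the sequence as `T n ∘ S n` with `T n` triangular and contracting and `S n` a
shear of degree `k`, and let `Φ n = T (n - 1) ∘ ⋯ ∘ T 0`. Then `f (n - 1) ∘ ⋯ ∘ f 0 = Φ n ∘ Ψ n`,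
where `Ψ n` is the composition of the first `n` of the maps `H n = (Φ n)⁻¹ ∘ S n ∘ Φ n`. If
`r = max ‖α‖ ‖β‖` and `q = min ‖α‖ ‖β‖`, then `Φ n` contracts like `r ^ n`, so that the shear moves
the points `Φ n y` by `O(r ^ (k * n))`, while `(Φ n)⁻¹` expands by `O(q ^ (-n))` only, since each
`T n` has a Jacobian of modulus `r * q`. As `r ^ k < q`, the maps `H n` are summably close to the
identity on bounded sets. Consequently `Ψ n` converges, on the open set of points with bounded
orbits, to a biholomorphic map onto the whole space. A point whose orbit under `f` tends to `0`
approaches it geometrically, which by Grönwall's inequality bounds its orbit under the `H n`;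
hence the set of bounded orbits is the basin.
-/

section UniformLimits

open Metric Finset

theorem exists_forall_sum_Ico_lt {s : ℕ → ℝ} (hs : Summable s) {ε : ℝ} (hε : 0 < ε) :
    ∃ N, ∀ m ≥ N, ∀ n, ∑ i ∈ Ico m n, s i < ε := by
  obtain ⟨t, ht⟩ := summable_iff_vanishing_norm.1 hs ε hε
  obtain ⟨N, hN⟩ := t.exists_nat_subset_range
  refine ⟨N, fun m hm n => (Real.le_norm_self _).trans_lt (ht _ ?_)⟩
  refine disjoint_left.2 fun i hi hit => ?_
  have := mem_range.1 (hN hit)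
  have := (mem_Ico.1 hi).1
  omega

theorem uniformCauchySeqOn_of_norm_succ_sub_le {X F : Type*} [NormedAddCommGroup F]
    {f : ℕ → X → F} {t : Set X} {u : ℕ → ℝ} (hu : Summable u)
    (hf : ∀ᶠ n in atTop, ∀ x ∈ t, ‖f (n + 1) x - f n x‖ ≤ u n) :
    UniformCauchySeqOn f atTop t := by
  refine Metric.uniformCauchySeqOn_iff.2 fun ε hε => ?_
  obtain ⟨N₁, hN₁⟩ := eventually_atTop.1 hf
  obtain ⟨N₂, hN₂⟩ := exists_forall_sum_Ico_lt hu hε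
  have hdist : ∀ m ≥ max N₁ N₂, ∀ n ≥ m, ∀ x ∈ t, dist (f m x) (f n x) < ε := by
    intro m hm n hmn x hx
    refine (dist_le_Ico_sum_of_dist_le (f := (f · x)) hmn fun {i} hi _ => ?_).trans_lt
      (hN₂ m (le_of_max_le_right hm) n)
    rw [dist_comm, dist_eq_norm]
    exact hN₁ i ((le_of_max_le_left hm).trans hi) x hx
  refine ⟨max N₁ N₂, fun m hm n hn x hx => ?_⟩
  rcases le_total m n with hmn | hnm
  · exact hdist m hm n hmn x hx
  · exact dist_comm (f m x) (f n x) ▸ hdist n hn m hnm x hx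

theorem exists_tendstoLocallyUniformlyOn_of_uniformCauchySeqOn {X F : Type*} [TopologicalSpace X]
    [NormedAddCommGroup F] [CompleteSpace F] {f : ℕ → X → F} {U : Set X}
    (h : ∀ x ∈ U, ∃ t ∈ 𝓝 x, UniformCauchySeqOn f atTop t) :
    ∃ g, TendstoLocallyUniformlyOn f g atTop U := by
  choose! t ht hf using h
  choose! g hg using fun x (hx : x ∈ U) =>
    cauchySeq_tendsto_of_complete ((hf x hx).cauchySeq (mem_of_mem_nhds (ht x hx)))
  refine ⟨g, fun u hu x hx => ⟨t x ∩ U,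
    inter_mem (mem_nhdsWithin_of_mem_nhds (ht x hx)) self_mem_nhdsWithin, ?_⟩⟩
  exact ((hf x hx).mono Set.inter_subset_left).tendstoUniformlyOn_of_tendsto
    (fun y hy => hg y hy.2) u hu

theorem mapsTo_closedBall_two_mul {X F : Type*} [SeminormedAddCommGroup F] {f : X → F} {s : Set X}
    {C : ℝ} (hf : ∀ z ∈ s, ‖f z‖ ≤ C) {c : X} (hc : c ∈ s) :
    Set.MapsTo f s (closedBall (f c) (2 * C)) := fun z hz => by
  rw [mem_closedBall_iff_norm]
  linarith [norm_sub_le (f z) (f c), hf z hz, hf c hc]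

variable {E F : Type*} [NormedAddCommGroup E] [NormedSpace ℂ E] [NormedAddCommGroup F]
  [NormedSpace ℂ F]

theorem uniformCauchySeqOn_fderiv {ι : Type*} {p : Filter ι} {f : ι → E → F} {x : E} {r : ℝ}
    (hr : 0 < r) (hd : ∀ n, DifferentiableOn ℂ (f n) (ball x (r + r)))
    (hf : UniformCauchySeqOn f p (ball x (r + r))) :
    UniformCauchySeqOn (fun n => fderiv ℂ (f n)) p (ball x r) := by
  intro u hu
  obtain ⟨ε, hε, hεu⟩ := Metric.mem_uniformity_dist.1 hu
  filter_upwards [hf _ (Metric.dist_mem_uniformity (show 0 < ε * r / 4 by positivity))]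
    with ⟨m, n⟩ hmn y hy
  refine hεu ?_
  have hsub : ball y r ⊆ ball x (r + r) := ball_subset_ball' (by linarith [mem_ball.1 hy])
  have hdiff : ∀ i, DifferentiableAt ℂ (f i) y := fun i =>
    (hd i).differentiableAt (isOpen_ball.mem_nhds (hsub (mem_ball_self hr)))
  rw [dist_eq_norm, ← fderiv_sub (hdiff m) (hdiff n)]
  have hsmall : ∀ z ∈ ball y r, ‖(f m - f n) z‖ ≤ ε * r / 4 := fun z hz => by
    simpa only [dist_eq_norm, Pi.sub_apply] using (hmn z (hsub hz)).le
  calc ‖fderiv ℂ (f m - f n) y‖ ≤ 2 * (ε * r / 4) / r :=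
        Complex.norm_fderiv_le_div_of_mapsTo_ball (((hd m).sub (hd n)).mono hsub)
          (mapsTo_closedBall_two_mul hsmall (mem_ball_self hr)) hr
    _ = ε / 2 := by field_simp; ring
    _ < ε := half_lt_self hε

theorem differentiableOn_of_tendstoLocallyUniformlyOn [ProperSpace E] [CompleteSpace F]
    {ι : Type*} {p : Filter ι} [p.NeBot] {f : ι → E → F} {g : E → F} {U : Set E} (hU : IsOpen U)
    (hf : TendstoLocallyUniformlyOn f g p U) (hd : ∀ n, DifferentiableOn ℂ (f n) U) :
    DifferentiableOn ℂ g U := by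
  intro x hx
  obtain ⟨R, hR, hRU⟩ := nhds_basis_closedBall.mem_iff.1 (hU.mem_nhds hx)
  obtain ⟨r, hr, rfl⟩ : ∃ r, 0 < r ∧ R = r + r := ⟨R / 2, half_pos hR, (add_halves R).symm⟩
  have hunif : TendstoUniformlyOn f g p (ball x (r + r)) :=
    ((tendstoLocallyUniformlyOn_iff_forall_isCompact hU).1 hf _ hRU
      (isCompact_closedBall x _)).mono ball_subset_closedBall
  have hcauchy := uniformCauchySeqOn_fderiv hr
    (fun n => (hd n).mono (ball_subset_closedBall.trans hRU)) hunif.uniformCauchySeqOn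
  choose! g' hg' using fun y (hy : y ∈ ball x r) =>
    cauchy_map_iff_exists_tendsto.1 (hcauchy.cauchy_map hy)
  have hsub : ball x r ⊆ U :=
    (ball_subset_closedBall.trans (closedBall_subset_closedBall (by linarith))).trans hRU
  have hderiv : HasFDerivAt g (g' x) x := hasFDerivAt_of_tendstoUniformlyOn isOpen_ball
    (hcauchy.tendstoUniformlyOn_of_tendsto fun y hy => hg' y hy)
    (fun n y hy => ((hd n).differentiableAt (hU.mem_nhds (hsub hy))).hasFDerivAt)
    (fun y hy => hf.tendsto_at (hsub hy)) (mem_ball_self hr)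
  exact hderiv.differentiableAt.differentiableWithinAt

end UniformLimits

section InfiniteComposition

open Metric Finset

/-- The permutation `f (n - 1) * ⋯ * f 1 * f 0`: the composition `nonautComp f n` together with
its inverse. -/
def nonautPerm {X : Type*} (f : ℕ → Equiv.Perm X) : ℕ → Equiv.Perm X
  | 0 => 1
  | n + 1 => f n * nonautPerm f n

theorem coe_nonautPerm {X : Type*} (f : ℕ → Equiv.Perm X) (n : ℕ) :
    ⇑(nonautPerm f n) = nonautComp (fun i => f i) n := by
  induction n with
  | zero => rfl
  | succ n ih => rw [nonautPerm, Equiv.Perm.coe_mul, ih, nonautComp]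

theorem nonautPerm_mem {X : Type*} {f : ℕ → Equiv.Perm X} {S : Subgroup (Equiv.Perm X)}
    (hf : ∀ n, f n ∈ S) (n : ℕ) : nonautPerm f n ∈ S := by
  induction n with
  | zero => exact S.one_mem
  | succ n ih => exact S.mul_mem (hf n) ih

variable {E : Type*} [NormedAddCommGroup E]

/-- Convergence of `H n` to the identity at a summable rate, uniformly on bounded sets. -/
def SummablyNearId (H : ℕ → Equiv.Perm E) : Prop :=
  ∀ R : ℝ, ∃ s : ℕ → ℝ, Summable s ∧ ∀ n y, ‖y‖ ≤ R → ‖H n y - y‖ ≤ s n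

/-- The points whose orbit under the compositions `H (n - 1) ∘ ⋯ ∘ H 0` is eventually bounded. -/
def boundedOrbits (H : ℕ → Equiv.Perm E) : Set E :=
  {z | ∃ R : ℝ, ∀ᶠ n in atTop, ‖nonautPerm H n z‖ ≤ R}

section Orbits

variable {H : ℕ → Equiv.Perm E} {s : ℕ → ℝ} {R : ℝ} {N : ℕ}

theorem norm_nonautPerm_le (hH : ∀ n y, ‖y‖ ≤ R → ‖H n y - y‖ ≤ s n) {z : E}
    (hR : ∀ n, ‖nonautPerm H N z‖ + ∑ i ∈ Ico N n, s i ≤ R) {n : ℕ} (hn : N ≤ n) :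
    ‖nonautPerm H n z‖ ≤ ‖nonautPerm H N z‖ + ∑ i ∈ Ico N n, s i := by
  induction n, hn using Nat.le_induction with
  | base => simp only [Ico_self, sum_empty, add_zero, le_refl]
  | succ n hn ih =>
    rw [sum_Ico_succ_top hn, ← add_assoc]
    calc ‖nonautPerm H (n + 1) z‖
        ≤ ‖nonautPerm H n z‖ + ‖H n (nonautPerm H n z) - nonautPerm H n z‖ :=
          norm_le_insert' _ _
      _ ≤ _ := add_le_add ih (hH n _ (ih.trans (hR n)))

theorem norm_nonautPerm_nonautPerm_inv_le (hH : ∀ n y, ‖y‖ ≤ R → ‖(H n)⁻¹ y - y‖ ≤ s n)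
    {n : ℕ} (hn : N ≤ n) :
    ∀ x : E, (∀ m ≥ N, ‖x‖ + ∑ i ∈ Ico m n, s i ≤ R) →
      ‖nonautPerm H N ((nonautPerm H n)⁻¹ x)‖ ≤ R := by
  induction n, hn using Nat.le_induction with
  | base =>
    intro x hx
    simpa only [Equiv.Perm.coe_inv, Equiv.apply_symm_apply, Ico_self, sum_empty, add_zero] using
      hx N le_rfl
  | succ n hn ih =>
    intro x hx
    have hstep : ‖(H n)⁻¹ x‖ ≤ ‖x‖ + s n := (norm_le_insert' _ x).trans
      (by
        gcongr
        exact hH n x (by simpa only [Ico_self, sum_empty, add_zero] using hx (n + 1) (by omega)))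
    have hprev : ∀ m ≥ N, m ≤ n → ‖(H n)⁻¹ x‖ + ∑ i ∈ Ico m n, s i ≤ R := fun m hm hmn => by
      have := hx m hm
      rw [sum_Ico_succ_top hmn] at this
      linarith
    rw [nonautPerm, mul_inv_rev, Equiv.Perm.mul_apply]
    refine ih _ fun m hm => ?_
    rcases le_total m n with hmn | hnm
    · exact hprev m hm hmn
    · simpa only [Ico_eq_empty_of_le hnm, Ico_self] using hprev n hn le_rfl

theorem exists_nhds_uniformCauchySeqOn_nonautPerm (hc : ∀ n, Continuous (nonautPerm H n))
    (hH : SummablyNearId H) {z : E} (hz : z ∈ boundedOrbits H) :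
    ∃ U ∈ 𝓝 z, U ⊆ boundedOrbits H ∧
      UniformCauchySeqOn (fun n => nonautPerm H n) atTop U := by
  obtain ⟨r, hr⟩ := hz
  obtain ⟨s, hs, hHs⟩ := hH (r + 2)
  obtain ⟨N₁, hN₁⟩ := exists_forall_sum_Ico_lt hs one_pos
  obtain ⟨N, hrN, hN⟩ := (hr.and (eventually_ge_atTop N₁)).exists
  have hU : ∀ x ∈ {x | ‖nonautPerm H N x‖ < r + 1}, ∀ n ≥ N, ‖nonautPerm H n x‖ ≤ r + 2 :=
    fun x hx n hn => by
      have hsum : ∀ n, ‖nonautPerm H N x‖ + ∑ i ∈ Ico N n, s i ≤ r + 2 := fun n => by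
        linarith [hN₁ N hN n, Set.mem_ofPred.1 hx]
      exact (norm_nonautPerm_le hHs hsum hn).trans (hsum n)
  refine ⟨{x | ‖nonautPerm H N x‖ < r + 1}, ?_, fun x hx => ?_, ?_⟩
  · exact (isOpen_lt (hc N).norm continuous_const).mem_nhds (hrN.trans_lt (lt_add_one r))
  · exact ⟨r + 2, (eventually_ge_atTop N).mono (hU x hx)⟩
  · exact uniformCauchySeqOn_of_norm_succ_sub_le hs
      ((eventually_ge_atTop N).mono fun n hn x hx => hHs n _ (hU x hx n hn))

theorem exists_eventually_norm_nonautPerm_inv_le [ProperSpace E]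
    (hc : ∀ n, Continuous ⇑(nonautPerm H n)⁻¹) (hH : SummablyNearId H⁻¹) (R : ℝ) :
    ∃ M, ∀ᶠ n in atTop, ∀ x, ‖x‖ ≤ R → ‖(nonautPerm H n)⁻¹ x‖ ≤ M := by
  obtain ⟨s, hs, hHs⟩ := hH (R + 1)
  obtain ⟨N, hN⟩ := exists_forall_sum_Ico_lt hs one_pos
  obtain ⟨M, hM⟩ := (isCompact_closedBall (0 : E) (R + 1)).exists_bound_of_continuousOn
    (hc N).continuousOn
  refine ⟨M, (eventually_ge_atTop N).mono fun n hn x hx => ?_⟩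
  have hle : ‖nonautPerm H N ((nonautPerm H n)⁻¹ x)‖ ≤ R + 1 :=
    norm_nonautPerm_nonautPerm_inv_le hHs hn x fun m hm => by linarith [hN m hm n]
  simpa only [Equiv.Perm.coe_inv, Equiv.symm_apply_apply] using
    hM _ (mem_closedBall_zero_iff.2 hle)

theorem mem_boundedOrbits_of_tendsto_nonautPerm_inv (hc : ∀ n, Continuous (nonautPerm H n))
    (hH : SummablyNearId H⁻¹) {w z : E}
    (hz : Tendsto (fun n => (nonautPerm H n)⁻¹ w) atTop (𝓝 z)) : z ∈ boundedOrbits H := by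
  obtain ⟨s, hs, hHs⟩ := hH (‖w‖ + 1)
  obtain ⟨N₀, hN₀⟩ := exists_forall_sum_Ico_lt hs one_pos
  refine ⟨‖w‖ + 1, (eventually_ge_atTop N₀).mono fun N hN => ?_⟩
  refine le_of_tendsto (((hc N).tendsto z).comp hz).norm ?_
  filter_upwards [eventually_ge_atTop N] with n hn
  exact norm_nonautPerm_nonautPerm_inv_le hHs hn w fun m hm => by
    linarith [hN₀ m (hN.trans hm) n]

end Orbits

section Holomorphic

variable [NormedSpace ℂ E]

variable (E) in
/-- The group of holomorphic automorphisms of `E`. -/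
def holAut : Subgroup (Equiv.Perm E) where
  carrier := {g | Differentiable ℂ g ∧ Differentiable ℂ ⇑g⁻¹}
  one_mem' := ⟨differentiable_id, differentiable_id⟩
  mul_mem' := fun {g h} hg hh => ⟨hg.1.comp hh.1, by
    rw [mul_inv_rev]
    exact hh.2.comp hg.2⟩
  inv_mem' := fun {g} hg => ⟨hg.2, by simpa only [inv_inv] using hg.1⟩

variable {H : ℕ → Equiv.Perm E}

theorem exists_nhds_uniformCauchySeqOn_nonautPerm_inv [ProperSpace E]
    (hd : ∀ n, H n ∈ holAut E) (hH : SummablyNearId H⁻¹) (w : E) :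
    ∃ V ∈ 𝓝 w, UniformCauchySeqOn (fun n => ⇑(nonautPerm H n)⁻¹) atTop V := by
  obtain ⟨s, hs, hHs⟩ := hH (‖w‖ + 1)
  obtain ⟨M, hM⟩ := exists_eventually_norm_nonautPerm_inv_le
    (fun n => (nonautPerm_mem hd n).2.continuous) hH (‖w‖ + 2)
  refine ⟨ball w 1, ball_mem_nhds w one_pos,
    uniformCauchySeqOn_of_norm_succ_sub_le (hs.mul_left (2 * M)) ?_⟩
  filter_upwards [hM, hs.tendsto_atTop_zero.eventually_lt_const one_pos] with n hMn hsn x hx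
  have hbound : ∀ y ∈ ball x 1, ‖(nonautPerm H n)⁻¹ y‖ ≤ M := fun y hy => hMn y <| by
    linarith [norm_lt_of_mem_ball hx, norm_lt_of_mem_ball hy]
  have hclose : ‖(H n)⁻¹ x - x‖ ≤ s n := hHs n x (norm_lt_of_mem_ball hx).le
  rw [nonautPerm, mul_inv_rev, Equiv.Perm.mul_apply, ← dist_eq_norm]
  calc dist ((nonautPerm H n)⁻¹ ((H n)⁻¹ x)) ((nonautPerm H n)⁻¹ x)
      ≤ 2 * M / 1 * dist ((H n)⁻¹ x) x :=
        Complex.dist_le_div_mul_dist_of_mapsTo_ball (nonautPerm_mem hd n).2.differentiableOn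
          (mapsTo_closedBall_two_mul hbound (mem_ball_self one_pos))
          (mem_ball_iff_norm.2 (hclose.trans_lt hsn))
    _ ≤ 2 * M * s n := by
        have hM0 : 0 ≤ M := (norm_nonneg _).trans (hbound x (mem_ball_self one_pos))
        rw [div_one, dist_eq_norm]
        gcongr

theorem biholomorphic_of_tendstoLocallyUniformlyOn [ProperSpace E] {g : ℕ → Equiv.Perm E}
    {φ ψ : E → E} {U V : Set E} (hg : ∀ n, g n ∈ holAut E) (hU : IsOpen U) (hV : IsOpen V)
    (hφ : TendstoLocallyUniformlyOn (fun n => g n) φ atTop U)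
    (hψ : TendstoLocallyUniformlyOn (fun n => ⇑(g n)⁻¹) ψ atTop V)
    (hφUV : Set.MapsTo φ U V) (hψVU : Set.MapsTo ψ V U) : Biholomorphic U V := by
  have hφd := differentiableOn_of_tendstoLocallyUniformlyOn hU hφ
    fun n => (hg n).1.differentiableOn
  have hψd := differentiableOn_of_tendstoLocallyUniformlyOn hV hψ
    fun n => (hg n).2.differentiableOn
  refine ⟨hU, hV, φ, ψ, hφd, hψd, hφUV, hψVU, fun z hz => ?_, fun w hw => ?_⟩
  · have hlim := hψ.tendsto_comp (hψd.continuousOn _ (hφUV hz)) (hφUV hz)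
      (by rw [hV.nhdsWithin_eq (hφUV hz)]; exact hφ.tendsto_at hz)
    simp only [Equiv.Perm.coe_inv, Equiv.symm_apply_apply] at hlim
    exact tendsto_nhds_unique hlim tendsto_const_nhds
  · have hlim := hφ.tendsto_comp (hφd.continuousOn _ (hψVU hw)) (hψVU hw)
      (by rw [hU.nhdsWithin_eq (hψVU hw)]; exact hψ.tendsto_at hw)
    simp only [Equiv.Perm.coe_inv, Equiv.apply_symm_apply] at hlim
    exact tendsto_nhds_unique hlim tendsto_const_nhds

theorem biholomorphic_boundedOrbits [ProperSpace E] (hd : ∀ n, H n ∈ holAut E)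
    (hH : SummablyNearId H) (hK : SummablyNearId H⁻¹) :
    Biholomorphic (boundedOrbits H) (Set.univ : Set E) := by
  have hlocal := fun z => exists_nhds_uniformCauchySeqOn_nonautPerm (z := z)
    (fun n => (nonautPerm_mem hd n).1.continuous) hH
  obtain ⟨φ, hφ⟩ := exists_tendstoLocallyUniformlyOn_of_uniformCauchySeqOn
    (f := fun n => nonautPerm H n) (U := boundedOrbits H)
    fun z hz => (hlocal z hz).imp fun U hU => ⟨hU.1, hU.2.2⟩
  obtain ⟨ψ, hψ⟩ := exists_tendstoLocallyUniformlyOn_of_uniformCauchySeqOn (U := Set.univ)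
    fun w _ => exists_nhds_uniformCauchySeqOn_nonautPerm_inv hd hK w
  have hopen : IsOpen (boundedOrbits H) := isOpen_iff_mem_nhds.2 fun z hz =>
    (hlocal z hz).elim fun U hU => mem_of_superset hU.1 hU.2.1
  exact biholomorphic_of_tendstoLocallyUniformlyOn (nonautPerm_mem hd) hopen isOpen_univ hφ hψ
    (Set.mapsTo_univ _ _) fun w hw => mem_boundedOrbits_of_tendsto_nonautPerm_inv
      (fun n => (nonautPerm_mem hd n).1.continuous) hK (hψ.tendsto_at hw)

end Holomorphic

end InfiniteComposition

section Conjugation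

open Finset

section Group

variable {X : Type*} (T S : ℕ → Equiv.Perm X)

/-- The map `S n` read in the coordinates transported by the compositions of the maps `T i`. -/
def conjAlong (n : ℕ) : Equiv.Perm X :=
  (nonautPerm T n)⁻¹ * S n * nonautPerm T n

theorem conjAlong_inv : (conjAlong T S)⁻¹ = conjAlong T S⁻¹ := by
  ext1 n
  simp only [conjAlong, Pi.inv_apply, mul_inv_rev, inv_inv, mul_assoc]

theorem nonautPerm_mul (n : ℕ) :
    nonautPerm (T * S) n = nonautPerm T n * nonautPerm (conjAlong T S) n := by
  induction n with
  | zero => rfl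
  | succ n ih => simp only [nonautPerm, conjAlong, ih, Pi.mul_apply]; group

end Group

variable {E : Type*} [NormedAddCommGroup E]

theorem exists_eventually_norm_nonautComp_le_mul_pow {f : ℕ → E → E} {D : ℝ} (hD : 0 < D)
    (hf : ∀ᶠ z in 𝓝 0, ∀ n, ‖f n z‖ ≤ D * ‖z‖) {z : E} (hz : z ∈ nonautBasin f 0) :
    ∃ W, ∀ᶠ n in atTop, ‖nonautComp f n z‖ ≤ W * D ^ n := by
  obtain ⟨N, hN⟩ := eventually_atTop.1 (hz.eventually hf)
  refine ⟨‖nonautComp f N z‖ / D ^ N, eventually_atTop.2 ⟨N, fun n hn => ?_⟩⟩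
  induction n, hn using Nat.le_induction with
  | base => rw [div_mul_cancel₀ _ (pow_pos hD N).ne']
  | succ n hn ih =>
    calc ‖nonautComp f (n + 1) z‖ ≤ D * ‖nonautComp f n z‖ := hN n hn n
      _ ≤ D * (‖nonautComp f N z‖ / D ^ N * D ^ n) := by gcongr
      _ = ‖nonautComp f N z‖ / D ^ N * D ^ (n + 1) := by ring

theorem exists_eventually_norm_le_of_norm_succ_sub_le {u : ℕ → ℝ} (hu : Summable u) {v : ℕ → E}
    (hv : ∀ᶠ n in atTop, ‖v (n + 1) - v n‖ ≤ u n * (1 + ‖v n‖)) :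
    ∃ R, ∀ᶠ n in atTop, ‖v n‖ ≤ R := by
  obtain ⟨N, hN⟩ := eventually_atTop.1 hv
  have hstep : ∀ n ≥ N, ‖v (n + 1)‖ ≤ (1 + |u n|) * ‖v n‖ + |u n| := fun n hn => by
    have hle : u n * (1 + ‖v n‖) ≤ |u n| * (1 + ‖v n‖) := by gcongr; exact le_abs_self _
    linarith [norm_le_insert' (v (n + 1)) (v n), hN n hn]
  have hsum : ∀ n, ∑ i ∈ Ico N n, |u i| ≤ ∑' i, |u i| := fun n =>
    hu.abs.sum_le_tsum _ fun i _ => abs_nonneg _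
  refine ⟨(‖v N‖ + ∑' i, |u i|) * Real.exp (∑' i, |u i|), eventually_atTop.2 ⟨N, fun n hn => ?_⟩⟩
  refine (discrete_gronwall (u := (‖v ·‖)) (norm_nonneg _) hstep (fun n _ => abs_nonneg _)
    (fun n _ => abs_nonneg _) hn).trans ?_
  gcongr <;> exact hsum n

/-- Closeness of `K n` to the identity, at a summable rate relative to `1 + ‖y‖`, on the points
`y` whose image under the first `n` maps of `T` is of size `O(D ^ n)`. -/
def SummablyNearIdAlong (T : ℕ → Equiv.Perm E) (D : ℝ) (K : ℕ → Equiv.Perm E) : Prop :=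
  ∀ W : ℝ, ∃ u : ℕ → ℝ, Summable u ∧
    ∀ n y, ‖nonautPerm T n y‖ ≤ W * D ^ n → ‖K n y - y‖ ≤ u n * (1 + ‖y‖)

/-- Decay of the compositions of the maps `T i` at the rate `D ^ n`, uniformly on bounded sets. -/
def DecaysOnBounded (T : ℕ → Equiv.Perm E) (D : ℝ) : Prop :=
  ∀ R : ℝ, ∃ W : ℝ, ∀ n y, ‖y‖ ≤ R → ‖nonautPerm T n y‖ ≤ W * D ^ n

variable {T S : ℕ → Equiv.Perm E} {D : ℝ}

theorem SummablyNearIdAlong.summablyNearId {K : ℕ → Equiv.Perm E}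
    (hK : SummablyNearIdAlong T D K) (hT : DecaysOnBounded T D) : SummablyNearId K := fun R => by
  obtain ⟨W, hW⟩ := hT R
  obtain ⟨u, hu, hKu⟩ := hK W
  refine ⟨fun n => |u n| * (1 + R), hu.abs.mul_right _, fun n y hy => ?_⟩
  calc ‖K n y - y‖ ≤ u n * (1 + ‖y‖) := hKu n y (hW n y hy)
    _ ≤ |u n| * (1 + R) := by gcongr; exact le_abs_self _

theorem nonautBasin_mul_eq_boundedOrbits (hD0 : 0 < D) (hD1 : D < 1)
    (hloc : ∀ᶠ z in 𝓝 (0 : E), ∀ n, ‖(T * S) n z‖ ≤ D * ‖z‖) (hT : DecaysOnBounded T D)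
    (hS : SummablyNearIdAlong T D (conjAlong T S)) :
    nonautBasin (fun n => (T * S) n) 0 = boundedOrbits (conjAlong T S) := by
  have hcomp : ∀ n z, nonautComp (fun n => (T * S) n) n z =
      nonautPerm T n (nonautPerm (conjAlong T S) n z) := fun n z => by
    rw [← coe_nonautPerm, nonautPerm_mul, Equiv.Perm.mul_apply]
  ext z
  constructor
  · intro hz
    obtain ⟨W, hW⟩ := exists_eventually_norm_nonautComp_le_mul_pow hD0 hloc hz
    obtain ⟨u, hu, hSu⟩ := hS W
    exact exists_eventually_norm_le_of_norm_succ_sub_le hu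
      (hW.mono fun n hn => hSu n _ (hcomp n z ▸ hn))
  · rintro ⟨R, hR⟩
    obtain ⟨W, hW⟩ := hT R
    refine squeeze_zero_norm' (a := fun n => W * D ^ n)
      (hR.mono fun n hn => by rw [hcomp]; exact hW n _ hn) ?_
    simpa only [mul_zero] using (tendsto_pow_atTop_nhds_zero_of_lt_one hD0.le hD1).const_mul W

theorem biholomorphic_nonautBasin_mul [NormedSpace ℂ E] [ProperSpace E]
    (hTd : ∀ n, T n ∈ holAut E) (hSd : ∀ n, S n ∈ holAut E) (hD0 : 0 < D) (hD1 : D < 1)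
    (hloc : ∀ᶠ z in 𝓝 (0 : E), ∀ n, ‖(T * S) n z‖ ≤ D * ‖z‖) (hT : DecaysOnBounded T D)
    (hS : SummablyNearIdAlong T D (conjAlong T S))
    (hS' : SummablyNearIdAlong T D (conjAlong T S⁻¹)) :
    Biholomorphic (nonautBasin (fun n => (T * S) n) 0) (Set.univ : Set E) := by
  rw [nonautBasin_mul_eq_boundedOrbits hD0 hD1 hloc hT hS]
  refine biholomorphic_boundedOrbits (fun n => ?_) (hS.summablyNearId hT) ?_
  · exact mul_mem (mul_mem (inv_mem (nonautPerm_mem hTd n)) (hSd n)) (nonautPerm_mem hTd n)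
  · rw [conjAlong_inv]
    exact hS'.summablyNearId hT

end Conjugation

section Triangular

open Finset

section CommRing

variable {R : Type*} [CommRing R]

/-- The automorphism `z ↦ (a z₁ + c z₂², b z₂)` of the plane. -/
def triPerm (a b : Rˣ) (c : R) : Equiv.Perm (R × R) where
  toFun z := (a * z.1 + c * z.2 ^ 2, b * z.2)
  invFun w := (↑a⁻¹ * (w.1 - c * (↑b⁻¹ * w.2) ^ 2), ↑b⁻¹ * w.2)
  left_inv z := by simp only [Units.inv_mul_cancel_left, add_sub_cancel_right]
  right_inv w := by simp only [Units.mul_inv_cancel_left, sub_add_cancel]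

/-- The shear `z ↦ (z₁, z₂ + s z₁ᵏ)` of the plane. -/
def shearPerm (k : ℕ) (s : R) : Equiv.Perm (R × R) where
  toFun z := (z.1, z.2 + s * z.1 ^ k)
  invFun w := (w.1, w.2 - s * w.1 ^ k)
  left_inv z := by simp only [add_sub_cancel_right]
  right_inv w := by simp only [sub_add_cancel]

theorem triPerm_mul (a b A B : Rˣ) (e c : R) :
    triPerm a b e * triPerm A B c = triPerm (a * A) (b * B) (a * c + e * B ^ 2) := by
  ext z <;> simp only [triPerm, Equiv.Perm.mul_apply, Equiv.coe_fn_mk, Units.val_mul] <;> ring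

theorem shearPerm_inv (k : ℕ) (s : R) : (shearPerm k s)⁻¹ = shearPerm k (-s) := by
  ext z
  · rfl
  · exact (sub_eq_add_neg _ _).trans (by rw [← neg_mul]; rfl)

/-- The coefficient of `z₂²` in the composition of the first `n` maps
`z ↦ (a i z₁ + e i z₂², b i z₂)`. -/
def quadCoeff (a b : ℕ → Rˣ) (e : ℕ → R) : ℕ → R
  | 0 => 0
  | n + 1 => a n * quadCoeff a b e n + e n * ↑(∏ i ∈ range n, b i) ^ 2

theorem nonautPerm_triPerm (a b : ℕ → Rˣ) (e : ℕ → R) (n : ℕ) :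
    nonautPerm (fun i => triPerm (a i) (b i) (e i)) n =
      triPerm (∏ i ∈ range n, a i) (∏ i ∈ range n, b i) (quadCoeff a b e n) := by
  induction n with
  | zero => ext z <;> simp [nonautPerm, triPerm, quadCoeff]
  | succ n ih =>
    rw [nonautPerm, ih, triPerm_mul, prod_range_succ_comm, prod_range_succ_comm, quadCoeff]

theorem conj_shearPerm_sub {A B : Rˣ} {c s δ : R} {k : ℕ} {y : R × R}
    (hδ : B * δ = s * (triPerm A B c y).1 ^ k) :
    ((triPerm A B c)⁻¹ * shearPerm k s * triPerm A B c) y - y =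
      (-(↑A⁻¹ * c * (2 * y.2 + δ) * δ), δ) := by
  have hshear : shearPerm k s (triPerm A B c y) = (A * y.1 + c * y.2 ^ 2, B * (y.2 + δ)) := by
    rw [mul_add, hδ]
    rfl
  rw [sub_eq_iff_eq_add, Equiv.Perm.mul_apply, Equiv.Perm.mul_apply, hshear]
  refine Equiv.Perm.inv_eq_iff_eq.2 (Prod.ext ?_ ?_)
  · change A * y.1 + c * y.2 ^ 2 =
      A * (-(↑A⁻¹ * c * (2 * y.2 + δ) * δ) + y.1) + c * (δ + y.2) ^ 2
    linear_combination (c * (2 * y.2 + δ) * δ) * A.mul_inv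
  · simp only [triPerm, Equiv.coe_fn_mk, Prod.snd_add, add_comm δ]

end CommRing

section NormedField

variable {𝕜 : Type*} [NormedField 𝕜]

theorem norm_triPerm_le {a b : 𝕜ˣ} {c : 𝕜} {r C : ℝ} (ha : ‖(a : 𝕜)‖ ≤ r) (hb : ‖(b : 𝕜)‖ ≤ r)
    (hc : ‖c‖ ≤ C) (z : 𝕜 × 𝕜) : ‖triPerm a b c z‖ ≤ (r + C * ‖z‖) * ‖z‖ := by
  have hr : 0 ≤ r := (norm_nonneg _).trans ha
  have hC : 0 ≤ C := (norm_nonneg _).trans hc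
  have h₁ := norm_fst_le z
  have h₂ := norm_snd_le z
  refine norm_prod_le_iff.2 ⟨?_, ?_⟩
  · calc ‖(a : 𝕜) * z.1 + c * z.2 ^ 2‖ ≤ ‖(a : 𝕜)‖ * ‖z.1‖ + ‖c‖ * ‖z.2‖ ^ 2 :=
          (norm_add_le _ _).trans_eq (by simp only [norm_mul, norm_pow])
      _ ≤ r * ‖z‖ + C * ‖z‖ ^ 2 := by gcongr
      _ = (r + C * ‖z‖) * ‖z‖ := by ring
  · calc ‖(b : 𝕜) * z.2‖ ≤ r * ‖z‖ := by rw [norm_mul]; gcongr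
      _ ≤ (r + C * ‖z‖) * ‖z‖ := by gcongr; exact le_add_of_nonneg_right (by positivity)

theorem norm_shearPerm_le (k : ℕ) (s : 𝕜) (z : 𝕜 × 𝕜) :
    ‖shearPerm k s z‖ ≤ ‖z‖ + ‖s‖ * ‖z‖ ^ k := by
  refine norm_prod_le_iff.2 ⟨?_, ?_⟩
  · exact (norm_fst_le z).trans (le_add_of_nonneg_right (by positivity))
  · calc ‖z.2 + s * z.1 ^ k‖ ≤ ‖z.2‖ + ‖s‖ * ‖z.1‖ ^ k :=
          (norm_add_le _ _).trans_eq (by simp only [norm_mul, norm_pow])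
      _ ≤ ‖z‖ + ‖s‖ * ‖z‖ ^ k := by
          gcongr
          exacts [norm_snd_le z, norm_fst_le z]

theorem norm_conj_shearPerm_sub_le {A B : 𝕜ˣ} {c s : 𝕜} {k : ℕ} {y : 𝕜 × 𝕜} {M X η : ℝ}
    (hM : 0 ≤ M) (hB : ‖(B : 𝕜)‖⁻¹ ≤ X) (hc : ‖(A : 𝕜)‖⁻¹ * ‖c‖ * ‖(B : 𝕜)‖⁻¹ ≤ M * X)
    (hη : ‖s‖ * ‖triPerm A B c y‖ ^ k * X ≤ η) :
    ‖((triPerm A B c)⁻¹ * shearPerm k s * triPerm A B c) y - y‖ ≤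
      (1 + M * (2 + η)) * η * (1 + ‖y‖) := by
  set σ : 𝕜 := s * (triPerm A B c y).1 ^ k with hσ
  set δ : 𝕜 := ↑B⁻¹ * σ with hδ
  have hX : 0 ≤ X := (inv_nonneg.2 (norm_nonneg _)).trans hB
  have hση : X * ‖σ‖ ≤ η := by
    refine le_trans ?_ hη
    rw [hσ, norm_mul, norm_pow, mul_comm X]
    gcongr
    exact norm_fst_le _
  have hη0 : 0 ≤ η := le_trans (by positivity) hση
  have hδσ : ‖δ‖ = ‖(B : 𝕜)‖⁻¹ * ‖σ‖ := by rw [hδ, norm_mul, Units.val_inv_eq_inv_val, norm_inv]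
  have hδη : ‖δ‖ ≤ η := hδσ.trans_le ((mul_le_mul_of_nonneg_right hB (norm_nonneg σ)).trans hση)
  have hsum : ‖2 * y.2 + δ‖ ≤ 2 * ‖y‖ + η := by
    rw [two_mul]
    linarith [norm_add₃_le (a := y.2) (b := y.2) (c := δ), norm_snd_le y]
  have hfst : ‖↑A⁻¹ * c * (2 * y.2 + δ) * δ‖ ≤ M * η * (2 * ‖y‖ + η) := calc
    _ = ‖(A : 𝕜)‖⁻¹ * ‖c‖ * ‖(B : 𝕜)‖⁻¹ * ‖σ‖ * ‖2 * y.2 + δ‖ := by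
      rw [norm_mul, hδσ, norm_mul, norm_mul, Units.val_inv_eq_inv_val, norm_inv]
      ring
    _ ≤ M * X * ‖σ‖ * (2 * ‖y‖ + η) := by gcongr
    _ = M * (X * ‖σ‖) * (2 * ‖y‖ + η) := by ring
    _ ≤ M * η * (2 * ‖y‖ + η) := by gcongr
  rw [conj_shearPerm_sub (B.mul_inv_cancel_left σ)]
  refine norm_prod_le_iff.2 ⟨(norm_neg _).trans_le (hfst.trans ?_), hδη.trans ?_⟩
  · have : 0 ≤ η * (1 + ‖y‖) + M * η * (2 + η * ‖y‖) := by positivity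
    linarith
  · have : 0 ≤ η * ‖y‖ + M * (2 + η) * η * (1 + ‖y‖) := by positivity
    linarith

variable {a b : ℕ → 𝕜ˣ} {e s : ℕ → 𝕜} {r q E S D : ℝ} {k : ℕ}

theorem norm_prod_range_le (ha : ∀ n, ‖(a n : 𝕜)‖ ≤ r) (n : ℕ) :
    ‖((∏ i ∈ range n, a i : 𝕜ˣ) : 𝕜)‖ ≤ r ^ n := by
  rw [Units.coe_prod, norm_prod]
  simpa only [prod_const, card_range] using
    prod_le_prod (s := range n) (fun i _ => norm_nonneg (a i : 𝕜)) fun i _ => ha i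

theorem norm_prod_range_mul_norm_prod_range {p : ℝ}
    (hab : ∀ n, ‖(a n : 𝕜)‖ * ‖(b n : 𝕜)‖ = p) (n : ℕ) :
    ‖((∏ i ∈ range n, a i : 𝕜ˣ) : 𝕜)‖ * ‖((∏ i ∈ range n, b i : 𝕜ˣ) : 𝕜)‖ = p ^ n := by
  simp only [Units.coe_prod, norm_prod, ← prod_mul_distrib, hab, prod_const, card_range]

theorem norm_quadCoeff_le (hr0 : 0 < r) (hr1 : r < 1) (ha : ∀ n, ‖(a n : 𝕜)‖ ≤ r)
    (hb : ∀ n, ‖(b n : 𝕜)‖ ≤ r) (he : ∀ n, ‖e n‖ ≤ E) (n : ℕ) :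
    ‖quadCoeff a b e n‖ ≤ E / (r * (1 - r)) * r ^ n := by
  have hE : 0 ≤ E := (norm_nonneg _).trans (he 0)
  have hr : 0 < 1 - r := sub_pos.2 hr1
  -- The factor `1 - r ^ n` absorbs the inhomogeneous term `e n * (b 0 ⋯ b (n - 1)) ^ 2`.
  suffices h : ‖quadCoeff a b e n‖ ≤ E / (r * (1 - r)) * r ^ n * (1 - r ^ n) from
    h.trans (mul_le_of_le_one_right (by positivity) (sub_le_self _ (by positivity)))
  induction n with
  | zero => simp only [quadCoeff, norm_zero, pow_zero, sub_self, mul_zero, le_refl]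
  | succ n ih =>
    have hB : ‖((∏ i ∈ range n, b i : 𝕜ˣ) : 𝕜)‖ ≤ r ^ n := norm_prod_range_le hb n
    calc ‖quadCoeff a b e (n + 1)‖
        ≤ ‖(a n : 𝕜)‖ * ‖quadCoeff a b e n‖ + ‖e n‖ * ‖((∏ i ∈ range n, b i : 𝕜ˣ) : 𝕜)‖ ^ 2 := by
          rw [quadCoeff, ← norm_pow, ← norm_mul, ← norm_mul]
          exact norm_add_le _ _
      _ ≤ r * (E / (r * (1 - r)) * r ^ n * (1 - r ^ n)) + E * (r ^ n) ^ 2 := by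
          gcongr
          exacts [ha n, he n]
      _ = E / (r * (1 - r)) * r ^ (n + 1) * (1 - r ^ (n + 1)) := by
          field_simp
          ring

theorem decaysOnBounded_triPerm (hr0 : 0 < r) (hr1 : r < 1) (ha : ∀ n, ‖(a n : 𝕜)‖ ≤ r)
    (hb : ∀ n, ‖(b n : 𝕜)‖ ≤ r) (he : ∀ n, ‖e n‖ ≤ E) (hrD : r ≤ D) :
    DecaysOnBounded (fun n => triPerm (a n) (b n) (e n)) D := fun R => by
  set M := E / (r * (1 - r))
  have hM : 0 ≤ M :=
    div_nonneg ((norm_nonneg _).trans (he 0)) (mul_nonneg hr0.le (sub_nonneg.2 hr1.le))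
  refine ⟨(1 + M * R) * R, fun n y hy => ?_⟩
  rw [nonautPerm_triPerm]
  have hR : 0 ≤ R := (norm_nonneg y).trans hy
  calc _ ≤ (r ^ n + M * r ^ n * ‖y‖) * ‖y‖ :=
        norm_triPerm_le (norm_prod_range_le ha n) (norm_prod_range_le hb n)
          (norm_quadCoeff_le hr0 hr1 ha hb he n) y
    _ = (1 + M * ‖y‖) * ‖y‖ * r ^ n := by ring
    _ ≤ (1 + M * R) * R * D ^ n := by gcongr

theorem pow_le_norm_prod_range (hr0 : 0 < r) (ha : ∀ n, ‖(a n : 𝕜)‖ ≤ r)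
    (hab : ∀ n, ‖(a n : 𝕜)‖ * ‖(b n : 𝕜)‖ = r * q) (n : ℕ) :
    q ^ n ≤ ‖((∏ i ∈ range n, b i : 𝕜ˣ) : 𝕜)‖ := by
  refine le_of_mul_le_mul_left ?_ (pow_pos hr0 n)
  rw [← mul_pow, ← norm_prod_range_mul_norm_prod_range hab n]
  gcongr
  exact norm_prod_range_le ha n

theorem norm_inv_mul_norm_quadCoeff_mul_norm_inv_le (hr0 : 0 < r) (hr1 : r < 1)
    (ha : ∀ n, ‖(a n : 𝕜)‖ ≤ r) (hb : ∀ n, ‖(b n : 𝕜)‖ ≤ r)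
    (hab : ∀ n, ‖(a n : 𝕜)‖ * ‖(b n : 𝕜)‖ = r * q) (he : ∀ n, ‖e n‖ ≤ E) (n : ℕ) :
    ‖((∏ i ∈ range n, a i : 𝕜ˣ) : 𝕜)‖⁻¹ * ‖quadCoeff a b e n‖ *
      ‖((∏ i ∈ range n, b i : 𝕜ˣ) : 𝕜)‖⁻¹ ≤ E / (r * (1 - r)) * (q ^ n)⁻¹ := by
  have hrq : 0 ≤ r * q := hab 0 ▸ by positivity
  calc _ = ‖quadCoeff a b e n‖ / (r * q) ^ n := by
        rw [← norm_prod_range_mul_norm_prod_range hab n, div_eq_mul_inv, mul_inv]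
        ring
    _ ≤ E / (r * (1 - r)) * r ^ n / (r * q) ^ n := by
        gcongr
        exact norm_quadCoeff_le hr0 hr1 ha hb he n
    _ = E / (r * (1 - r)) * (q ^ n)⁻¹ := by
        rw [mul_pow, mul_div_assoc, div_mul_cancel_left₀ (pow_pos hr0 n).ne']

theorem summablyNearIdAlong_conjAlong_shearPerm (hr0 : 0 < r) (hr1 : r < 1)
    (ha : ∀ n, ‖(a n : 𝕜)‖ ≤ r) (hb : ∀ n, ‖(b n : 𝕜)‖ ≤ r)
    (hab : ∀ n, ‖(a n : 𝕜)‖ * ‖(b n : 𝕜)‖ = r * q) (he : ∀ n, ‖e n‖ ≤ E)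
    (hs : ∀ n, ‖s n‖ ≤ S) (hD : 0 < D) (hDq : D ^ k < q) :
    SummablyNearIdAlong (fun n => triPerm (a n) (b n) (e n)) D
      (conjAlong (fun n => triPerm (a n) (b n) (e n)) fun n => shearPerm k (s n)) := fun W => by
  have hq : 0 < q := (pow_pos hD k).trans hDq
  have hS : 0 ≤ S := (norm_nonneg _).trans (hs 0)
  set M := E / (r * (1 - r))
  have hM : 0 ≤ M :=
    div_nonneg ((norm_nonneg _).trans (he 0)) (mul_nonneg hr0.le (sub_nonneg.2 hr1.le))
  set θ := D ^ k / q with hθ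
  have hθ0 : 0 ≤ θ := by positivity
  have hθ1 : θ < 1 := (div_lt_one hq).2 hDq
  refine ⟨fun n => (1 + M * (2 + S * W ^ k)) * (S * W ^ k * θ ^ n),
    ((summable_geometric_of_lt_one hθ0 hθ1).mul_left _).mul_left _, fun n y hy => ?_⟩
  rw [nonautPerm_triPerm] at hy
  rw [conjAlong, nonautPerm_triPerm]
  have hW : 0 ≤ W := nonneg_of_mul_nonneg_left ((norm_nonneg _).trans hy) (pow_pos hD n)
  have hB := inv_anti₀ (pow_pos hq n) (pow_le_norm_prod_range hr0 ha hab n)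
  have hc := norm_inv_mul_norm_quadCoeff_mul_norm_inv_le hr0 hr1 ha hb hab he n
  have hη : ‖s n‖ * ‖triPerm _ _ (quadCoeff a b e n) y‖ ^ k * (q ^ n)⁻¹ ≤
      S * W ^ k * θ ^ n := calc
    _ ≤ S * (W * D ^ n) ^ k * (q ^ n)⁻¹ := by
      gcongr
      exact hs n
    _ = S * W ^ k * θ ^ n := by rw [hθ, div_pow, mul_pow, pow_right_comm]; ring
  have hηW : S * W ^ k * θ ^ n ≤ S * W ^ k :=
    mul_le_of_le_one_right (by positivity) (pow_le_one₀ hθ0 hθ1.le)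
  refine (norm_conj_shearPerm_sub_le hM hB hc hη).trans ?_
  beta_reduce
  gcongr

theorem eventually_norm_triPerm_mul_shearPerm_le (ha : ∀ n, ‖(a n : 𝕜)‖ ≤ r)
    (hb : ∀ n, ‖(b n : 𝕜)‖ ≤ r) (he : ∀ n, ‖e n‖ ≤ E) (hs : ∀ n, ‖s n‖ ≤ S) (hk : 2 ≤ k)
    (hrD : r < D) :
    ∀ᶠ z in 𝓝 (0 : 𝕜 × 𝕜), ∀ n,
      ‖(triPerm (a n) (b n) (e n) * shearPerm k (s n)) z‖ ≤ D * ‖z‖ := by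
  obtain ⟨j, rfl⟩ := Nat.exists_eq_add_of_le' hk
  set ρ : ℝ → ℝ := fun x => 1 + S * x ^ (j + 1) with hρ
  have hshear : ∀ n z, ‖shearPerm (j + 2) (s n) z‖ ≤ ρ ‖z‖ * ‖z‖ := fun n z =>
    (norm_shearPerm_le _ _ z).trans <| by
      rw [hρ, add_mul, one_mul, mul_assoc, ← pow_succ]
      gcongr
      exact hs n
  have hlim : Tendsto (fun z : 𝕜 × 𝕜 => (r + E * (ρ ‖z‖ * ‖z‖)) * ρ ‖z‖) (𝓝 0) (𝓝 r) :=
    Continuous.tendsto' (by fun_prop) _ _ (by simp [hρ])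
  filter_upwards [hlim.eventually_lt_const hrD] with z hz n
  have hr : 0 ≤ r := (norm_nonneg _).trans (ha 0)
  have hE : 0 ≤ E := (norm_nonneg _).trans (he 0)
  calc _ ≤ (r + E * ‖shearPerm (j + 2) (s n) z‖) * ‖shearPerm (j + 2) (s n) z‖ :=
        norm_triPerm_le (ha n) (hb n) (he n) _
    _ ≤ (r + E * (ρ ‖z‖ * ‖z‖)) * (ρ ‖z‖ * ‖z‖) := by
        have : 0 ≤ ρ ‖z‖ * ‖z‖ := (norm_nonneg _).trans (hshear n z)
        gcongr <;> exact hshear n z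
    _ = (r + E * (ρ ‖z‖ * ‖z‖)) * ρ ‖z‖ * ‖z‖ := by ring
    _ ≤ D * ‖z‖ := by gcongr

end NormedField

theorem triPerm_mem_holAut (a b : ℂˣ) (c : ℂ) : triPerm a b c ∈ holAut (ℂ × ℂ) := by
  constructor <;>
    simp only [triPerm, Equiv.Perm.coe_inv, Equiv.coe_fn_mk, Equiv.coe_fn_symm_mk] <;>
    fun_prop

theorem shearPerm_mem_holAut (k : ℕ) (s : ℂ) : shearPerm k s ∈ holAut (ℂ × ℂ) := by
  constructor <;>
    simp only [shearPerm, Equiv.Perm.coe_inv, Equiv.coe_fn_mk, Equiv.coe_fn_symm_mk] <;>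
    fun_prop

theorem biholomorphic_nonautBasin_triPerm_mul_shearPerm {a b : ℕ → ℂˣ} {e s : ℕ → ℂ}
    {r q E S : ℝ} {k : ℕ} (hk : 2 ≤ k) (hr1 : r < 1) (hrq : r ^ k < q)
    (ha : ∀ n, ‖(a n : ℂ)‖ ≤ r) (hb : ∀ n, ‖(b n : ℂ)‖ ≤ r)
    (hab : ∀ n, ‖(a n : ℂ)‖ * ‖(b n : ℂ)‖ = r * q) (he : ∀ n, ‖e n‖ ≤ E) (hs : ∀ n, ‖s n‖ ≤ S) :
    Biholomorphic
      (nonautBasin (fun n => triPerm (a n) (b n) (e n) * shearPerm k (s n)) 0)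
      (Set.univ : Set (ℂ × ℂ)) := by
  have hr0 : 0 < r := (norm_pos_iff.2 (a 0).ne_zero).trans_le (ha 0)
  obtain ⟨D, hDq, hrD, hD1⟩ : ∃ D, D ^ k < q ∧ r < D ∧ D < 1 := by
    have hcont : Tendsto (fun x => x ^ k) (𝓝[>] r) (𝓝 (r ^ k)) :=
      ((continuous_pow k).tendsto r).mono_left nhdsWithin_le_nhds
    exact ((hcont.eventually_lt_const hrq).and (Ioo_mem_nhdsGT hr1)).exists
  have hD0 := hr0.trans hrD
  refine biholomorphic_nonautBasin_mul (fun n => triPerm_mem_holAut _ _ _)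
    (fun n => shearPerm_mem_holAut k (s n)) hD0 hD1
    (eventually_norm_triPerm_mul_shearPerm_le ha hb he hs hk hrD)
    (decaysOnBounded_triPerm hr0 hr1 ha hb he hrD.le)
    (summablyNearIdAlong_conjAlong_shearPerm hr0 hr1 ha hb hab he hs hD0 hDq) ?_
  have hinv : (fun n => shearPerm k (s n))⁻¹ = fun n => shearPerm k (-s n) :=
    funext fun n => shearPerm_inv k (s n)
  rw [hinv]
  exact summablyNearIdAlong_conjAlong_shearPerm hr0 hr1 ha hb hab he
    (fun n => (norm_neg (s n)).trans_le (hs n)) hD0 hDq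

end Triangular

theorem pow_lt_of_pow_lt_of_le_pow_sub_one {x y : ℝ} {k : ℕ} (hk : 2 ≤ k) (hx : 0 ≤ x)
    (hxy : x ^ k < y) (hyx : y ≤ x ^ (k - 1)) : y ^ k < x := by
  have hx1 : x < 1 := by
    by_contra! h
    exact (hxy.trans_le hyx).not_ge (pow_le_pow_right₀ h (k.sub_le 1))
  have hyx' : y ≤ x := hyx.trans (pow_le_of_le_one hx hx1.le (by omega))
  have hy : 0 ≤ y := (pow_nonneg hx k).trans hxy.le
  calc y ^ k ≤ x ^ k := by gcongr
    _ < y := hxy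
    _ ≤ x := hyx'

theorem exists_eq_triPerm_mul_shearPerm {α β : ℂ} (hα : α ≠ 0) (hβ : β ≠ 0) {k : ℕ}
    {g : ℂ × ℂ → ℂ × ℂ} (hg : g = mapF α β ∨ g = mapG α β k) :
    ∃ (a b : ℂˣ) (e s : ℂ), g = ⇑(triPerm a b e * shearPerm k s) ∧
      ‖(a : ℂ)‖ ≤ max ‖α‖ ‖β‖ ∧ ‖(b : ℂ)‖ ≤ max ‖α‖ ‖β‖ ∧
      ‖(a : ℂ)‖ * ‖(b : ℂ)‖ = max ‖α‖ ‖β‖ * min ‖α‖ ‖β‖ ∧ ‖e‖ ≤ 1 ∧ ‖s‖ ≤ ‖α‖⁻¹ := by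
  rcases hg with rfl | rfl
  · refine ⟨Units.mk0 α hα, Units.mk0 β hβ, 1, 0, ?_, le_max_left _ _, le_max_right _ _,
      (max_mul_min _ _).symm, norm_one.le, by simp⟩
    ext z <;> simp [mapF, triPerm, shearPerm]
  · refine ⟨Units.mk0 β hβ, Units.mk0 α hα, 0, α⁻¹, ?_, le_max_right _ _, le_max_left _ _,
      (mul_comm _ _).trans (max_mul_min _ _).symm, by simp, (norm_inv α).le⟩
    ext z
    · simp [mapG, triPerm, shearPerm]
    · simp [mapG, triPerm, shearPerm, mul_add, hα]

theorem proposition1p2_general {α β : ℂ} {k : ℕ} (hk : 2 ≤ k)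
    (hαβ : ‖α‖ ^ k < ‖β‖) (hβα : ‖β‖ ^ k < ‖α‖)
    {f : ℕ → ℂ × ℂ → ℂ × ℂ} (hf : ∀ n, f n = mapF α β ∨ f n = mapG α β k) :
    Biholomorphic (nonautBasin f 0) (Set.univ : Set (ℂ × ℂ)) := by
  have hα : α ≠ 0 := norm_pos_iff.1 ((pow_nonneg (norm_nonneg β) k).trans_lt hβα)
  have hβ : β ≠ 0 := norm_pos_iff.1 ((pow_nonneg (norm_nonneg α) k).trans_lt hαβ)
  have hrq : max ‖α‖ ‖β‖ ^ k < min ‖α‖ ‖β‖ := by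
    rcases le_total ‖α‖ ‖β‖ with h | h
    · rwa [max_eq_right h, min_eq_left h]
    · rwa [max_eq_left h, min_eq_right h]
  have hr1 : max ‖α‖ ‖β‖ < 1 := by
    by_contra! h
    exact (hrq.trans_le min_le_max).not_ge (le_self_pow₀ h (by omega))
  choose a b e s hfs ha hb hab he hs using fun n =>
    exists_eq_triPerm_mul_shearPerm hα hβ (hf n)
  rw [funext hfs]
  exact biholomorphic_nonautBasin_triPerm_mul_shearPerm hk hr1 hrq ha hb hab he hs

theorem proposition1p2 (α β : ℂ) (k : ℕ) (hk : 2 ≤ k)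
    (hβ_lower : ‖α‖ ^ k < ‖β‖) (hβ_upper : ‖β‖ ≤ ‖α‖ ^ (k - 1))
    (f : ℕ → ℂ × ℂ → ℂ × ℂ) (hf : ∀ n, f n = mapF α β ∨ f n = mapG α β k) :
    Biholomorphic (nonautBasin f 0) (Set.univ : Set (ℂ × ℂ)) :=
  proposition1p2_general hk hβ_lower
    (pow_lt_of_pow_lt_of_le_pow_sub_one hk (norm_nonneg α) hβ_lower hβ_upper) hf
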